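/- **Model.** $k\ge 1$ identical deterministic finite-state ants move on the grid $\mathbb Z^2$ and start at the nest $(0,0)$. A treasure lies in a cell $(x,y)$ at (Manhattan) distance $D=|x|+|y|$. Layer $l$ is the set of cells at distance $l$ from the nest. In each synchronous round $t=0,1,2,\dots$ every active ant, simultaneously, (1) senses whether there is a pheromone in its cell, (2) decides from its state and this bit on an optional emission of a pheromone in its cell, a move (north, east, south, west or stay) and its next state, and (3) executes them. Initially there are no pheromones; an emitted pheromone stays forever. The ants are released gradually: ant $i$ ($1\le i\le k$) waits in the nest and performs its first step in round $r_i$, where $r_1<r_2<\dots<r_k$ are arbitrary. The treasure is found at the first time $T$ (after $T$ rounds) at which an active ant stands on its cell. **Algorithm** (each move is one step; sensing and emitting cost no extra step). An ant starts as a newbie and repeats the following phases forever. 1. *Eastern ray.* A *newbie* repeats: step east; emit if no pheromone is sensed; step north; idle for one round; then, if no pheromone is sensed, emit and step south, which ends the repetition; otherwise step south and continue. A *veteran* steps east until it senses no pheromone; there it emits, steps north, emits, and steps south. Then go west to the nest (the first pheromone-free cell). 2. *Other rays.* Step south until no pheromone is sensed, emit, go back north to the nest; do the same to the west, going back east; then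 step north until no pheromone is sensed and emit there, in a cell $(0,l)$. In this round the ant *starts exploring* layer $l$ and becomes a veteran. 3. *Exploration.* Alternate steps east and south until a pheromone is sensed both right before and right after a step south; then alternate steps south and west until a pheromone is sensed; then west and north until a pheromone is sensed; then north and east until a pheromone is sensed. Then step south until no pheromone is sensed (the nest), and repeat from phase 1 as a veteran. **Theorem.** There is an absolute constant $C$ such that for all $k\ge 1$, all release times $r_1<\dots<r_k$, all $D\in\mathbb N$ and every treasure cell at distance $D$, the treasure is found, and the time $T$ at which it is found satisfies $$T\;\le\; r_{m}+C\Bigl(D+\frac{D^2}{k}\Bigr),\qquad m=\max(1,\min(k,D)),$$ so that, apart from the nest-emission time, the search takes $O(D+D^2/k)$ rounds; and at most $C\,D$ pheromones are emitted (counting every emission by every ant) during these $T$ rounds. Moreover, for all $k$ and all release times $r_1<\dots<r_k$, in the execution continued forever: no two distinct ants ever collide, i.e. no two distinct active ants are ever in the same cell in the same state at the same time; each layer $l$ is started by at most one ant, and at most once, so that distinct ants explore distinct layers; and an ant that starts exploring layer $l$ in round $t$ visits every cell of layer $l$ at times between $t$ and $t+8l$. -/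

import Mathlib

namespace AntForaging

/-! ### The synchronous model: finite-state ants on the grid, pheromones, gradual release -/

/-- Grid cells; the first coordinate grows to the east, the second one to the north. -/
abbrev Cell : Type := ℤ × ℤ

/-- The nest is the origin of the grid. -/
def nest : Cell := (0, 0)

/-- Manhattan distance of a cell from the nest; layer `l` is the set of cells with `dist c = l`. -/
def dist (c : Cell) : ℕ := c.1.natAbs + c.2.natAbs

/-- The five possible moves of an ant in one step. -/
inductive Move : Type
  | north | east | south | west | stay

/-- The effect of a move on the position. -/
def Move.apply : Move → Cell → Cell
  | .north, c => (c.1, c.2 + 1)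
  | .east, c => (c.1 + 1, c.2)
  | .south, c => (c.1, c.2 - 1)
  | .west, c => (c.1 - 1, c.2)
  | .stay, c => c

/-- What an ant decides in one step: whether to emit a pheromone in the cell where it stands,
how to move afterwards, and its next state. -/
structure Action (S : Type) : Type where
  emit : Bool
  move : Move
  next : S

/-- A deterministic finite state machine ant: an initial state, and the action it performs as a
function of its state and of whether it senses a pheromone in its cell. -/
structure AntFSM (S : Type) [Finite S] : Type where
  start : S
  act : S → Bool → Action S

/-- A global configuration of `k` ants. -/
structure Config (S : Type) (k : ℕ) : Type where
  pos : Fin k → Cell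
  state : Fin k → S
  /-- `pher c = true` when a pheromone is present in the cell `c`. -/
  pher : Cell → Bool

section Execution

variable {S : Type} [Finite S] (M : AntFSM S) {k : ℕ} (release : Fin k → ℕ)

/-- Initially all ants are in the nest, and there is no pheromone. -/
def initConfig : Config S k where
  pos := fun _ => nest
  state := fun _ => M.start
  pher := fun _ => false

/-- The action that ant `i` chooses in configuration `γ`. -/
def Config.action (γ : Config S k) (i : Fin k) : Action S :=
  M.act (γ.state i) (γ.pher (γ.pos i))

/-- Ant `i` is active from round `release i` on; before, it waits in the nest. -/
def Active (t : ℕ) (i : Fin k) : Prop := release i ≤ t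

instance (t : ℕ) (i : Fin k) : Decidable (Active release t i) :=
  inferInstanceAs (Decidable (release i ≤ t))

/-- Round `t`: all active ants simultaneously sense, then emit, move, and change state.
A pheromone, once emitted, stays forever. -/
def roundStep (t : ℕ) (γ : Config S k) : Config S k where
  pos := fun i => if Active release t i then (γ.action M i).move.apply (γ.pos i) else γ.pos i
  state := fun i => if Active release t i then (γ.action M i).next else γ.state i
  pher := fun c => γ.pher c ||
    decide (∃ i, Active release t i ∧ (γ.action M i).emit = true ∧ γ.pos i = c)

/-- `run M release t` is the configuration at the beginning of round `t`, where the rounds are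
numbered `0, 1, 2, …`; that is, the configuration after `t` rounds. -/
def run : ℕ → Config S k
  | 0 => initConfig M
  | t + 1 => roundStep M release t (run t)

/-- At time `t` some active ant stands on the cell `c`. -/
def FoundAt (c : Cell) (t : ℕ) : Prop :=
  ∃ i, Active release t i ∧ (run M release t).pos i = c

/-- The number of pheromones emitted during the rounds `0, …, T - 1`, every single emission by an
ant being counted (also in a cell that already holds a pheromone, or where another ant
emits in the same round). -/
def pheromonesEmitted (T : ℕ) : ℕ :=
  ∑ t ∈ Finset.range T, (Finset.univ.filter fun i : Fin k =>
    Active release t i ∧ ((run M release t).action M i).emit = true).card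

/-- Two distinct ants collide at time `t` if both are active and they are in the same cell in the
same state; being deterministic, they behave identically from then on. -/
def Collide (t : ℕ) (i j : Fin k) : Prop :=
  i ≠ j ∧ Active release t i ∧ Active release t j ∧
    (run M release t).pos i = (run M release t).pos j ∧
    (run M release t).state i = (run M release t).state j

end Execution

/-! ### The newbie / veteran algorithm -/

/-- Control states of the algorithm. In the states for an exploration, `zig` / `zag` tell whether
the last step was the first or the second one of the alternating pair of directions. -/
inductive SyncState : Type
  /-- newbie in the nest or back on the eastern ray, about to step east -/
  | newbieEast
  /-- newbie that just stepped east -/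
  | newbieRay
  /-- newbie north of the eastern ray, idling for one round -/
  | newbieIdle
  /-- newbie north of the eastern ray, after the idle round -/
  | newbieCheck
  /-- veteran that just stepped east -/
  | veteranRay
  /-- veteran that just stepped north of the cell by which it extended the eastern ray -/
  | veteranNorth
  /-- going west on the eastern ray, back to the nest -/
  | eastBack
  | southOut
  | southBack
  | westOut
  | westBack
  | northOut
  /-- exploring (east, south), having just stepped east -/
  | zigES
  /-- exploring (east, south), having just stepped south; the flag tells whether a pheromone was
  sensed in the cell before -/
  | zagES (sensed : Bool)
  | zigSW
  | zagSW
  | zigWN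
  | zagWN
  | zigNE
  | zagNE
  /-- going south on the northern ray, back to the nest -/
  | home
  deriving Fintype, DecidableEq

open SyncState in
/-- The transition table; the Boolean tells whether a pheromone is sensed.

* Eastern ray, newbie: step east; emit if there is no pheromone; step north; idle for one round; if
  there is then no pheromone, emit, step south, and the ray is extended; otherwise step
  south and repeat.
* Eastern ray, veteran: step east; if there is a pheromone, repeat; otherwise emit, step north,
  emit, step south, and the ray is extended.
* Other rays: go outwards until a pheromone-free cell, emit there, and go back to the nest, which
  is recognized by the lack of a pheromone (after the northern ray, do not go back).
* Exploration: alternate steps east and south until the cells before and after a step south both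
  have a pheromone; then alternate south and west, then west and north, then north and
  east, each until a pheromone is sensed; then go south to the nest and restart as a veteran. -/
def syncAct : SyncState → Bool → Action SyncState
  | newbieEast, _ => ⟨false, .east, newbieRay⟩
  | newbieRay, p => ⟨!p, .north, newbieIdle⟩
  | newbieIdle, _ => ⟨false, .stay, newbieCheck⟩
  | newbieCheck, true => ⟨false, .south, newbieEast⟩
  | newbieCheck, false => ⟨true, .south, eastBack⟩
  | veteranRay, true => ⟨false, .east, veteranRay⟩
  | veteranRay, false => ⟨true, .north, veteranNorth⟩
  | veteranNorth, _ => ⟨true, .south, eastBack⟩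
  | eastBack, true => ⟨false, .west, eastBack⟩
  | eastBack, false => ⟨false, .south, southOut⟩
  | southOut, true => ⟨false, .south, southOut⟩
  | southOut, false => ⟨true, .north, southBack⟩
  | southBack, true => ⟨false, .north, southBack⟩
  | southBack, false => ⟨false, .west, westOut⟩
  | westOut, true => ⟨false, .west, westOut⟩
  | westOut, false => ⟨true, .east, westBack⟩
  | westBack, true => ⟨false, .east, westBack⟩
  | westBack, false => ⟨false, .north, northOut⟩
  | northOut, true => ⟨false, .north, northOut⟩
  | northOut, false => ⟨true, .east, zigES⟩
  | zigES, p => ⟨false, .south, zagES p⟩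
  | zagES q, p => if q && p then ⟨false, .south, zigSW⟩ else ⟨false, .east, zigES⟩
  | zigSW, true => ⟨false, .west, zigWN⟩
  | zigSW, false => ⟨false, .west, zagSW⟩
  | zagSW, true => ⟨false, .west, zigWN⟩
  | zagSW, false => ⟨false, .south, zigSW⟩
  | zigWN, true => ⟨false, .north, zigNE⟩
  | zigWN, false => ⟨false, .north, zagWN⟩
  | zagWN, true => ⟨false, .north, zigNE⟩
  | zagWN, false => ⟨false, .west, zigWN⟩
  | zigNE, true => ⟨false, .south, home⟩
  | zigNE, false => ⟨false, .east, zagNE⟩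
  | zagNE, true => ⟨false, .south, home⟩
  | zagNE, false => ⟨false, .north, zigNE⟩
  | home, true => ⟨false, .south, home⟩
  | home, false => ⟨false, .east, veteranRay⟩

/-- The newbie / veteran algorithm for synchronous finite-state ants. -/
def syncAnt : AntFSM SyncState where
  start := .newbieEast
  act := syncAct

/-- In round `t` ant `i` starts to explore layer `l`: having extended the other three rays, it goes
along the northern ray and finds `(0, l)` free of pheromones. (In that round it emits
there and makes the first step of its zig-zag.) -/
def StartsLayer {k : ℕ} (release : Fin k → ℕ) (t : ℕ) (i : Fin k) (l : ℕ) : Prop :=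
  Active release t i ∧ (run syncAnt release t).state i = .northOut ∧
    (run syncAnt release t).pos i = (0, (l : ℤ)) ∧ (run syncAnt release t).pher (0, (l : ℤ)) = false

end AntForaging

namespace AntForaging

/-! ### Closed-form trajectories of a single ant. -/

open SyncState

/-! Everything is measured from claims: a layer l is claimed when an ant emits in (l, 1). From a
claim until its next one, the ant's cell and state are explicit functions of l and the elapsed time
(`DutyAt`): 6l rounds on the rays, 8l on the layer, l back to the nest, then east again. `NewbieAt`
plays this role before the first claim. These schedules hold only if ants sense the right bits, and
the marks are laid by other ants on the same schedules, so schedules and pheromones are controlled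
together in one induction over rounds (`Inv`).

Layers are claimed in increasing order, each once, with claim times growing by at least one round
per layer. Hence the ant of a lower layer is ahead of the ant of a higher one at every common cell
and state. This excludes collisions, and an ant going out along a ray finds every mark below its
layer but not its own (`Inv.emitted_iff`). A claim is unique because of the idle round: if a veteran
and a newbie reach a free ray cell together, the veteran marks the cell to the north while the
newbie idles, and the newbie gives way. Two simultaneous claimants of the same kind would collide.

While layer D is unclaimed nobody passes column D, so an ant's successive claims are O(D) rounds
apart. Sharing the D - 1 lower layers among the first min(k, D) ants, pigeonhole bounds the claim
time of D, and 14D + 1 further rounds suffice. Each pair (state, cell) serves for at most one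
emission, and only O(D) cells are in reach. -/

/-- Position and state of a newbie `a` rounds after its release. -/
def NewbieAt (a x y : ℤ) : SyncState → Prop
  | newbieEast => y = 0 ∧ 0 ≤ x ∧ a = 4 * x
  | newbieRay => y = 0 ∧ 1 ≤ x ∧ a = 4 * x - 3
  | newbieIdle => y = 1 ∧ 1 ≤ x ∧ a = 4 * x - 2
  | newbieCheck => y = 1 ∧ 1 ≤ x ∧ a = 4 * x - 1
  | _ => False

/-- Position and state of an ant `a` rounds after it extended the eastern ray to `(l, 0)`, until
it extends the eastern ray again. -/
def DutyAt (l a x y : ℤ) : SyncState → Prop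
  | eastBack => y = 0 ∧ 0 ≤ x ∧ x ≤ l ∧ a = l - x
  | southOut => x = 0 ∧ -l ≤ y ∧ y ≤ -1 ∧ a = l - y
  | southBack => x = 0 ∧ -l < y ∧ y ≤ 0 ∧ a = 3 * l + y
  | westOut => y = 0 ∧ -l ≤ x ∧ x ≤ -1 ∧ a = 3 * l - x
  | westBack => y = 0 ∧ -l < x ∧ x ≤ 0 ∧ a = 5 * l + x
  | northOut => x = 0 ∧ 1 ≤ y ∧ y ≤ l ∧ a = 5 * l + y
  | zigES => x + y = l + 1 ∧ 1 ≤ x ∧ x ≤ l ∧ a = 6 * l + 2 * x - 1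
  | zagES q => x + y = l ∧ 1 ≤ x ∧ x ≤ l ∧ a = 6 * l + 2 * x ∧ (q = true ↔ x = l)
  | zigSW => x - y = l + 1 ∧ 1 ≤ x ∧ x ≤ l ∧ a = 10 * l + 1 - 2 * x
  | zagSW => x - y = l ∧ 0 ≤ x ∧ x < l ∧ a = 10 * l - 2 * x
  | zigWN => x + y = -l - 1 ∧ -l ≤ x ∧ x ≤ -1 ∧ a = 10 * l - 1 - 2 * x
  | zagWN => x + y = -l ∧ -l ≤ x ∧ x ≤ -1 ∧ a = 10 * l - 2 * x
  | zigNE => y - x = l + 1 ∧ -l ≤ x ∧ x ≤ -1 ∧ a = 14 * l + 1 + 2 * x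
  | zagNE => y - x = l ∧ -l < x ∧ x ≤ 0 ∧ a = 14 * l + 2 * x
  | home => x = 0 ∧ 0 ≤ y ∧ y ≤ l - 1 ∧ a = 15 * l - y
  | veteranRay => y = 0 ∧ 1 ≤ x ∧ a = 15 * l + x
  | veteranNorth => y = 1 ∧ 1 ≤ x ∧ a = 15 * l + x + 1
  | _ => False

/-- The bit that an ant which is busy with layer `l` senses. -/
def Senses (l x y : ℤ) (p : Bool) : SyncState → Prop
  | eastBack => p = true ↔ x ≠ 0
  | southOut => p = true ↔ y ≠ -l
  | southBack => p = true ↔ y ≠ 0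
  | westOut => p = true ↔ x ≠ -l
  | westBack => p = true ↔ x ≠ 0
  | northOut => p = true ↔ y ≠ l
  | zigES => p = true ↔ x = l
  -- Only one implication: the cell (l - 1, 1), visited just before the corner, can be marked too;
  -- the flag of `zagES` rules out this false alarm.
  | zagES _ => x = l → p = true
  | zigSW => p = false
  | zagSW => p = true ↔ x = 0
  | zigWN => p = false
  | zagWN => p = true ↔ y = 0
  | zigNE => p = false
  | zagNE => p = true ↔ x = 0
  | home => p = true ↔ y ≠ 0
  | _ => True

/-- `veteranNorth` is excluded because its step south begins the duty for a new layer. -/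
theorem DutyAt.step {l a x y : ℤ} {q : SyncState} {p : Bool} (hl : 1 ≤ l)
    (h : DutyAt l a x y q) (hp : Senses l x y p q) (hq : q ≠ veteranNorth) :
    DutyAt l (a + 1) ((syncAct q p).move.apply (x, y)).1 ((syncAct q p).move.apply (x, y)).2
      (syncAct q p).next := by
  rcases q with _ | _ | _ | _ | _ | _ | _ | _ | _ | _ | _ | _ | _ | q | _ | _ | _ | _ | _ | _ | _
  case zagES =>
    cases q <;> cases p <;> simp [DutyAt, Senses, syncAct, Move.apply] at h hp ⊢ <;> omega
  all_goals
    cases p <;> simp [DutyAt, Senses, syncAct, Move.apply] at h hp hq ⊢ <;> omega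

theorem NewbieAt.step {a x y : ℤ} {q : SyncState} {p : Bool}
    (h : NewbieAt a x y q) (hq : ¬ (q = newbieCheck ∧ p = false)) :
    NewbieAt (a + 1) ((syncAct q p).move.apply (x, y)).1 ((syncAct q p).move.apply (x, y)).2
      (syncAct q p).next := by
  cases q <;> cases p <;>
    simp [NewbieAt, syncAct, Move.apply] at h hq ⊢ <;> omega

theorem NewbieAt.unique {a a' x y : ℤ} {q : SyncState}
    (h : NewbieAt a x y q) (h' : NewbieAt a' x y q) : a = a' := by
  cases q <;> simp [NewbieAt] at h h' <;> omega

theorem not_newbieAt_of_dutyAt {l a a' x y x' y' : ℤ} {q : SyncState}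
    (h : DutyAt l a x y q) (h' : NewbieAt a' x' y' q) : False := by
  cases q <;> simp_all [NewbieAt, DutyAt]

/-- During exploration the cell and state determine the layer; elsewhere the layer enters the
elapsed time with a positive coefficient, so a later claim of a higher layer leaves the ant strictly
behind. -/
theorem DutyAt.unique {l l' a a' s s' x y : ℤ} {q : SyncState} (hl : l < l') (hs : s < s')
    (ha : s + a = s' + a') (h : DutyAt l a x y q) (h' : DutyAt l' a' x y q) : False := by
  cases q <;> simp [DutyAt] at h h' <;> omega

/-! ### Claims and the invariant. -/

section Run

variable {k : ℕ} (r : Fin k → ℕ)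

/-- In round `t` ant `i` emits in `(l, 1)`, which completes the cells of layer `l` on the
eastern ray: the ant is going to explore layer `l`. -/
def Claims (t : ℕ) (i : Fin k) (l : ℤ) : Prop :=
  Active r t i ∧ (run syncAnt r t).pos i = (l, 1) ∧
    ((run syncAnt r t).state i = veteranNorth ∨
      (run syncAnt r t).state i = newbieCheck ∧ (run syncAnt r t).pher (l, 1) = false)

/-- Some ant has claimed layer `l` in a round before `t`. -/
def ClaimedBefore (t : ℕ) (l : ℤ) : Prop := ∃ s < t, ∃ i, Claims r s i l

/-- What is known about the eastern ray around an ant. -/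
def RayAt (t : ℕ) (x : ℤ) : SyncState → Prop
  | newbieEast => 1 ≤ x → ClaimedBefore r t x
  | newbieRay => 2 ≤ x → ClaimedBefore r t (x - 1)
  | newbieIdle => (2 ≤ x → ClaimedBefore r t (x - 1)) ∧ (run syncAnt r t).pher (x, 0) = true
  | newbieCheck => (2 ≤ x → ClaimedBefore r t (x - 1)) ∧ (run syncAnt r t).pher (x, 0) = true
  -- The bound `t + 1` is needed: the veteran may have passed a newbie that claims the previous
  -- column in the current round.
  | veteranRay => 2 ≤ x → ClaimedBefore r (t + 1) (x - 1)
  -- A veteran emits here without looking, so no earlier claim and no newbie checking now may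
  -- interfere.
  | veteranNorth => (2 ≤ x → ClaimedBefore r t (x - 1)) ∧
      (run syncAnt r t).pher (x, 0) = true ∧ ¬ ClaimedBefore r t x ∧
      ∀ j, (run syncAnt r t).state j = newbieCheck → (run syncAnt r t).pos j ≠ (x, 1)
  | _ => True

/-- The invariant of the execution. -/
structure Inv (t : ℕ) : Prop where
  ant : ∀ i, (t ≤ r i ∧ (run syncAnt r t).pos i = (0, 0) ∧
        (run syncAnt r t).state i = newbieEast) ∨
      (r i ≤ t ∧ NewbieAt (t - r i) ((run syncAnt r t).pos i).1 ((run syncAnt r t).pos i).2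
        ((run syncAnt r t).state i)) ∨
      ∃ s l, s < t ∧ Claims r s i l ∧ DutyAt l (t - s - 1) ((run syncAnt r t).pos i).1
        ((run syncAnt r t).pos i).2 ((run syncAnt r t).state i)
  -- The ant's next claim comes in round `s + 3 + 15 * l` at the earliest, just after this window.
  duty : ∀ s i l, s < t → Claims r s i l → (t : ℤ) ≤ s + 2 + 15 * l →
      DutyAt l (t - s - 1) ((run syncAnt r t).pos i).1
        ((run syncAnt r t).pos i).2 ((run syncAnt r t).state i)
  unique : ∀ s i s' j l, s < t → s' < t → Claims r s i l → Claims r s' j l → s = s' ∧ i = j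
  pred : ∀ s i l, s < t → Claims r s i l → 1 ≤ l ∧ (2 ≤ l → ClaimedBefore r s (l - 1))
  ray : ∀ i, RayAt r t ((run syncAnt r t).pos i).1 ((run syncAnt r t).state i)
  pher_lane : ∀ x, 1 ≤ x → ((run syncAnt r t).pher (x, 1) = true ↔ ClaimedBefore r t x)
  pher_south : ∀ d, 1 ≤ d → ((run syncAnt r t).pher (0, -d) = true ↔
    ∃ s i, Claims r s i d ∧ (s : ℤ) + 1 + 2 * d < t)
  pher_west : ∀ d, 1 ≤ d → ((run syncAnt r t).pher (-d, 0) = true ↔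
    ∃ s i, Claims r s i d ∧ (s : ℤ) + 1 + 4 * d < t)
  pher_north : ∀ d, 1 ≤ d → ((run syncAnt r t).pher (0, d) = true ↔
    ∃ s i, Claims r s i d ∧ (s : ℤ) + 1 + 6 * d < t)
  -- The ray mark precedes the claim by one round for a veteran and by two for a newbie.
  pher_ray : ∀ x, 1 ≤ x → (run syncAnt r t).pher (x, 0) = true → ClaimedBefore r (t + 1) x ∨
    ∃ i, (run syncAnt r t).state i = newbieIdle ∧ (run syncAnt r t).pos i = (x, 1)
  ray_pher : ∀ x, ClaimedBefore r t x → (run syncAnt r t).pher (x, 0) = true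
  pher_only : ∀ x y, (run syncAnt r t).pher (x, y) = true →
    (x = 0 ∧ y ≠ 0) ∨ (y = 0 ∧ x ≠ 0) ∨ (y = 1 ∧ 1 ≤ x)

variable {r}

theorem ClaimedBefore.mono {t t' : ℕ} {l : ℤ} (h : ClaimedBefore r t l) (ht : t ≤ t') :
    ClaimedBefore r t' l := by
  obtain ⟨s, hs, i, hi⟩ := h
  exact ⟨s, by omega, i, hi⟩

theorem inv_zero : Inv r 0 where
  ant i := Or.inl ⟨Nat.zero_le _, rfl, rfl⟩
  duty s i l hs := absurd hs (Nat.not_lt_zero _)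
  unique s i s' j l hs := absurd hs (Nat.not_lt_zero _)
  pred s i l hs := absurd hs (Nat.not_lt_zero _)
  ray i := by
    show RayAt r 0 0 newbieEast
    simp [RayAt]
  pher_lane x _ := by simp [run, initConfig, ClaimedBefore]
  pher_south x hx := by
    simp only [run, initConfig, Bool.false_eq_true, false_iff, not_exists, not_and]
    intros; push_cast; omega
  pher_west x hx := by
    simp only [run, initConfig, Bool.false_eq_true, false_iff, not_exists, not_and]
    intros; push_cast; omega
  pher_north x hx := by
    simp only [run, initConfig, Bool.false_eq_true, false_iff, not_exists, not_and]
    intros; push_cast; omega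
  pher_ray x _ h := by simp [run, initConfig] at h
  ray_pher x h := by simp [ClaimedBefore] at h
  pher_only x y h := by simp [run, initConfig] at h

theorem run_succ_pos {t : ℕ} {i : Fin k} (h : Active r t i) :
    (run syncAnt r (t + 1)).pos i =
      (syncAct ((run syncAnt r t).state i)
        ((run syncAnt r t).pher ((run syncAnt r t).pos i))).move.apply
        ((run syncAnt r t).pos i) := by
  simp [run, roundStep, h, Config.action, syncAnt]

theorem run_succ_state {t : ℕ} {i : Fin k} (h : Active r t i) :
    (run syncAnt r (t + 1)).state i =
      (syncAct ((run syncAnt r t).state i)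
        ((run syncAnt r t).pher ((run syncAnt r t).pos i))).next := by
  simp [run, roundStep, h, Config.action, syncAnt]

theorem run_succ_pos_of_not {t : ℕ} {i : Fin k} (h : ¬ Active r t i) :
    (run syncAnt r (t + 1)).pos i = (run syncAnt r t).pos i := by
  simp [run, roundStep, h]

theorem run_succ_state_of_not {t : ℕ} {i : Fin k} (h : ¬ Active r t i) :
    (run syncAnt r (t + 1)).state i = (run syncAnt r t).state i := by
  simp [run, roundStep, h]

variable (r) in
/-- In round `t` ant `i` emits a pheromone. -/
def Emits (t : ℕ) (i : Fin k) : Prop :=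
  Active r t i ∧ (syncAct ((run syncAnt r t).state i)
    ((run syncAnt r t).pher ((run syncAnt r t).pos i))).emit = true

theorem run_succ_pher {t : ℕ} {c : Cell} :
    (run syncAnt r (t + 1)).pher c = true ↔ (run syncAnt r t).pher c = true ∨
      ∃ i, Emits r t i ∧ (run syncAnt r t).pos i = c := by
  rw [run, roundStep, Bool.or_eq_true, decide_eq_true_iff]
  simp [Config.action, syncAnt, Emits, and_assoc]

theorem pher_mono {t t' : ℕ} (h : t ≤ t') {c : Cell} (hc : (run syncAnt r t).pher c = true) :
    (run syncAnt r t').pher c = true := by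
  induction t', h using Nat.le_induction with
  | base => exact hc
  | succ n _ ih => exact run_succ_pher.2 (Or.inl ih)

theorem Active.mono {t t' : ℕ} {i : Fin k} (h : Active r t i) (ht : t ≤ t') : Active r t' i :=
  le_trans (show r i ≤ t from h) ht

theorem Claims.emits {t : ℕ} {i : Fin k} {l : ℤ} (h : Claims r t i l) : Emits r t i := by
  obtain ⟨ha, hp, hq | ⟨hq, hf⟩⟩ := h
  · exact ⟨ha, by simp [hq, syncAct]⟩
  · exact ⟨ha, by simp [hq, hp, hf, syncAct]⟩

theorem Claims.next {t : ℕ} {i : Fin k} {l : ℤ} (h : Claims r t i l) :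
    (run syncAnt r (t + 1)).pos i = (l, 0) ∧ (run syncAnt r (t + 1)).state i = eastBack := by
  obtain ⟨ha, hp, hq | ⟨hq, hf⟩⟩ := h
  · rw [run_succ_pos ha, run_succ_state ha, hq, hp]; simp [syncAct, Move.apply]
  · rw [run_succ_pos ha, run_succ_state ha, hq, hp, hf]; simp [syncAct, Move.apply]

/-! ### Order of the claims, and the bits an ant senses. -/

namespace Inv

variable {t : ℕ}

theorem claimed_sub (H : Inv r t) {s : ℕ} {i : Fin k} {l : ℤ} (hs : s < t)
    (h : Claims r s i l) (n : ℕ) (hn : 1 ≤ l - n) :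
    ∃ s' j, s' + n ≤ s ∧ Claims r s' j (l - n) := by
  induction n with
  | zero => exact ⟨s, i, le_rfl, by simpa using h⟩
  | succ n ih =>
    obtain ⟨s', j, hs', hj⟩ := ih (by push_cast at hn; omega)
    obtain ⟨u, hu, m, hm⟩ := (H.pred s' j _ (by omega) hj).2 (by push_cast at hn; omega)
    refine ⟨u, m, by omega, ?_⟩
    convert hm using 1
    push_cast; ring

theorem claimed_of_le (H : Inv r t) {s : ℕ} {i : Fin k} {l l' : ℤ} (hs : s < t)
    (h : Claims r s i l) (h1 : 1 ≤ l') (h2 : l' ≤ l) :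
    ∃ (s' : ℕ) (j : Fin k), (s' : ℤ) + (l - l') ≤ s ∧ Claims r s' j l' := by
  obtain ⟨s', j, hs', hj⟩ := H.claimed_sub hs h (l - l').toNat (by omega)
  exact ⟨s', j, by omega, by convert hj using 1; omega⟩

theorem claims_add_le (H : Inv r t) {s s' : ℕ} {i j : Fin k} {l l' : ℤ} (hs : s < t)
    (hs' : s' < t) (h : Claims r s i l) (h' : Claims r s' j l') (hl : l ≤ l') :
    (s : ℤ) + (l' - l) ≤ s' := by
  obtain ⟨u, m, hu, hm⟩ := H.claimed_of_le hs' h' (H.pred s i l hs h).1 hl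
  have := (H.unique s i u m l hs (by omega) h hm).1
  omega

theorem ClaimedBefore_of_le (H : Inv r t) {u : ℕ} {l l' : ℤ} (hu : u ≤ t)
    (h : ClaimedBefore r u l) (h1 : 1 ≤ l') (h2 : l' ≤ l) : ClaimedBefore r u l' := by
  obtain ⟨s, hs, i, hi⟩ := h
  obtain ⟨s', j, h3, h4⟩ := H.claimed_of_le (by omega) hi h1 h2
  exact ⟨s', by omega, j, h4⟩

/-- A pheromone that is emitted `c * d` rounds after the claim of layer `d` is sensed by an ant
that is busy with a higher layer `l`, but not by the one that emits it. -/
theorem emitted_iff (H : Inv r t) {s : ℕ} {i : Fin k} {l d c : ℤ} (hs : s < t)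
    (hi : Claims r s i l) (hd : 1 ≤ d) (hdl : d ≤ l)
    (ht : (t : ℤ) = s + 1 + ((c - 1) * l + d)) (hcl : 1 ≤ c) :
    (∃ (u : ℕ) (j : Fin k), Claims r u j d ∧ (u : ℤ) + 1 + c * d < t) ↔ d ≠ l := by
  constructor
  · rintro ⟨u, j, hj, hu⟩ rfl
    have : 0 ≤ c * d := mul_nonneg (by omega) (by omega)
    obtain ⟨rfl, -⟩ := H.unique s i u j d hs (by omega) hi hj
    linarith
  · intro h
    obtain ⟨u, j, h3, h4⟩ := H.claimed_of_le hs hi hd hdl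
    refine ⟨u, j, h4, ?_⟩
    have : 0 ≤ (c - 1) * (l - d) := mul_nonneg (by omega) (by omega)
    have : d < l := by omega
    nlinarith

theorem not_pher (H : Inv r t) {x y : ℤ} (h1 : ¬ (x = 0 ∧ y ≠ 0)) (h2 : ¬ (y = 0 ∧ x ≠ 0))
    (h3 : ¬ (y = 1 ∧ 1 ≤ x)) : (run syncAnt r t).pher (x, y) = false := by
  by_contra h
  have := H.pher_only x y (by simpa using h)
  tauto

theorem senses (H : Inv r t) {s : ℕ} {i : Fin k} {l x y : ℤ} {q : SyncState} (hs : s < t)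
    (hi : Claims r s i l) (h : DutyAt l (t - s - 1) x y q) :
    Senses l x y ((run syncAnt r t).pher (x, y)) q := by
  have hl := (H.pred s i l hs hi).1
  have hray : ∀ x, 1 ≤ x → x ≤ l → (run syncAnt r t).pher (x, 0) = true := fun x h1 h2 =>
    H.ray_pher x (H.ClaimedBefore_of_le le_rfl ⟨s, hs, i, hi⟩ h1 h2)
  have hlane : ∀ x, 1 ≤ x → x ≤ l → (run syncAnt r t).pher (x, 1) = true := fun x h1 h2 =>
    (H.pher_lane x h1).2 (H.ClaimedBefore_of_le le_rfl ⟨s, hs, i, hi⟩ h1 h2)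
  have hnest := H.not_pher (x := 0) (y := 0) (by simp) (by simp) (by simp)
  cases q
  all_goals simp only [DutyAt, Senses] at h ⊢
  case eastBack =>
    obtain ⟨rfl, h1, h2, h3⟩ := h
    by_cases hx : x = 0
    · subst hx; simp [hnest]
    · simp [hx, hray x (by omega) h2]
  case southOut =>
    obtain ⟨rfl, h1, h2, h3⟩ := h
    have := H.pher_south (-y) (by omega)
    rw [neg_neg] at this
    rw [this, H.emitted_iff hs hi (by omega) (by omega) (by omega) (by norm_num)]
    omega
  case southBack =>
    obtain ⟨rfl, h1, h2, h3⟩ := h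
    by_cases hy : y = 0
    · subst hy; simp [hnest]
    · have := H.pher_south (-y) (by omega)
      rw [neg_neg] at this
      simp only [ne_eq, hy, not_false_eq_true, iff_true]
      obtain ⟨u, j, h5, h6⟩ := H.claimed_of_le hs hi (l' := -y) (by omega) (by omega)
      exact this.2 ⟨u, j, h6, by omega⟩
  case westOut =>
    obtain ⟨rfl, h1, h2, h3⟩ := h
    have := H.pher_west (-x) (by omega)
    rw [neg_neg] at this
    rw [this, H.emitted_iff hs hi (by omega) (by omega) (by omega) (by norm_num)]
    omega
  case westBack =>
    obtain ⟨rfl, h1, h2, h3⟩ := h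
    by_cases hx : x = 0
    · subst hx; simp [hnest]
    · have := H.pher_west (-x) (by omega)
      rw [neg_neg] at this
      simp only [ne_eq, hx, not_false_eq_true, iff_true]
      obtain ⟨u, j, h5, h6⟩ := H.claimed_of_le hs hi (l' := -x) (by omega) (by omega)
      exact this.2 ⟨u, j, h6, by omega⟩
  case northOut =>
    obtain ⟨rfl, h1, h2, h3⟩ := h
    rw [H.pher_north y h1,
      H.emitted_iff hs hi (by omega) (by omega) (by omega) (by norm_num)]
  case zigES =>
    obtain ⟨h0, h1, h2, h3⟩ := h
    by_cases hx : x = l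
    · obtain rfl : y = 1 := by omega
      simp [hx, hlane l hl le_rfl]
    · simp [hx, H.not_pher (x := x) (y := y) (by omega) (by omega) (by omega)]
  case zagES =>
    rintro rfl
    obtain rfl : y = 0 := by omega
    exact hray x hl le_rfl
  case zigSW =>
    exact H.not_pher (by omega) (by omega) (by omega)
  case zagSW =>
    obtain ⟨h0, h1, h2, h3⟩ := h
    by_cases hx : x = 0
    · obtain rfl : y = -l := by omega
      subst hx
      simp only [iff_true]
      exact (H.pher_south l hl).2 ⟨s, i, hi, by omega⟩
    · simp [hx, H.not_pher (x := x) (y := y) (by omega) (by omega) (by omega)]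
  case zigWN =>
    exact H.not_pher (by omega) (by omega) (by omega)
  case zagWN =>
    obtain ⟨h0, h1, h2, h3⟩ := h
    by_cases hy : y = 0
    · obtain rfl : x = -l := by omega
      subst hy
      simp only [iff_true]
      exact (H.pher_west l hl).2 ⟨s, i, hi, by omega⟩
    · simp [hy, H.not_pher (x := x) (y := y) (by omega) (by omega) (by omega)]
  case zigNE =>
    exact H.not_pher (by omega) (by omega) (by omega)
  case zagNE =>
    obtain ⟨h0, h1, h2, h3⟩ := h
    by_cases hx : x = 0
    · obtain rfl : y = l := by omega
      subst hx
      simp only [iff_true]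
      exact (H.pher_north y hl).2 ⟨s, i, hi, by omega⟩
    · simp [hx, H.not_pher (x := x) (y := y) (by omega) (by omega) (by omega)]
  case home =>
    obtain ⟨rfl, h1, h2, h3⟩ := h
    by_cases hy : y = 0
    · subst hy; simp [hnest]
    · simp only [ne_eq, hy, not_false_eq_true, iff_true]
      obtain ⟨u, j, h5, h6⟩ := H.claimed_of_le hs hi (l' := y) (by omega) (by omega)
      exact (H.pher_north y (by omega)).2 ⟨u, j, h6, by omega⟩

end Inv

theorem DutyAt.eq_southOut {l x y : ℤ} {q : SyncState} (hl : 1 ≤ l)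
    (h : DutyAt l (2 * l) x y q) : q = southOut ∧ x = 0 ∧ y = -l := by
  cases q <;> simp [DutyAt] at h ⊢ <;> omega

theorem DutyAt.eq_westOut {l x y : ℤ} {q : SyncState} (hl : 1 ≤ l)
    (h : DutyAt l (4 * l) x y q) : q = westOut ∧ x = -l ∧ y = 0 := by
  cases q <;> simp [DutyAt] at h ⊢ <;> omega

theorem DutyAt.eq_northOut {l x y : ℤ} {q : SyncState} (hl : 1 ≤ l)
    (h : DutyAt l (6 * l) x y q) : q = northOut ∧ x = 0 ∧ y = l := by
  cases q <;> simp [DutyAt] at h ⊢ <;> omega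

theorem claimedBefore_succ {t : ℕ} {l : ℤ} :
    ClaimedBefore r (t + 1) l ↔ ClaimedBefore r t l ∨ ∃ i, Claims r t i l := by
  constructor
  · rintro ⟨s, hs, i, hi⟩
    rcases Nat.lt_succ_iff_lt_or_eq.1 hs with h | rfl
    · exact Or.inl ⟨s, h, i, hi⟩
    · exact Or.inr ⟨i, hi⟩
  · rintro (h | ⟨i, hi⟩)
    · exact h.mono (Nat.le_succ t)
    · exact ⟨t, Nat.lt_succ_self t, i, hi⟩

/-! ### Claims and emissions of the current round. -/

namespace Inv

variable {t : ℕ}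

theorem ant_of_active (H : Inv r t) {i : Fin k} (hi : Active r t i) :
    NewbieAt (t - r i) ((run syncAnt r t).pos i).1 ((run syncAnt r t).pos i).2
        ((run syncAnt r t).state i) ∨
      ∃ s l, s < t ∧ Claims r s i l ∧ DutyAt l (t - s - 1) ((run syncAnt r t).pos i).1
        ((run syncAnt r t).pos i).2 ((run syncAnt r t).state i) := by
  rcases H.ant i with ⟨h1, h2, h3⟩ | ⟨-, h⟩ | h
  · left
    have : r i ≤ t := hi
    rw [h2, h3]
    exact ⟨rfl, le_rfl, by dsimp only; omega⟩
  · exact Or.inl h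
  · exact Or.inr h

theorem inactive (H : Inv r t) {i : Fin k} (hi : ¬ Active r t i) :
    t < r i ∧ (run syncAnt r t).pos i = (0, 0) ∧ (run syncAnt r t).state i = newbieEast := by
  have h : t < r i := not_le.1 hi
  rcases H.ant i with ⟨h1, h2, h3⟩ | ⟨h1, -⟩ | ⟨s, l, h1, h2, -⟩
  · exact ⟨h, h2, h3⟩
  · omega
  · exact absurd (h2.1.mono h1.le) hi

/-- The fields `pred` and `unique` concern past claims only; this supplies their extension to the
current round. -/
theorem claims_now (H : Inv r t) {i : Fin k} {l : ℤ} (hi : Claims r t i l) :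
    1 ≤ l ∧ (2 ≤ l → ClaimedBefore r t (l - 1)) ∧ ¬ ClaimedBefore r t l ∧
      (run syncAnt r t).pher (l, 0) = true := by
  have h1 := H.ant_of_active hi.1
  have h2 := H.ray i
  obtain ⟨ha, hp, hq | ⟨hq, hf⟩⟩ := hi
  · rw [hp, hq] at h1 h2
    simp only [NewbieAt, DutyAt, RayAt] at h1 h2
    refine ⟨?_, h2.1, h2.2.2.1, h2.2.1⟩
    rcases h1 with h1 | ⟨s, l', -, -, h1⟩
    · exact h1.elim
    · exact h1.2.1
  · rw [hp, hq] at h1 h2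
    simp only [NewbieAt, DutyAt, RayAt] at h1 h2
    have hl : 1 ≤ l := by
      rcases h1 with h1 | ⟨s, l', -, -, h1⟩
      · exact h1.2.1
      · exact h1.elim
    refine ⟨hl, h2.1, fun h => ?_, h2.2⟩
    rw [(H.pher_lane l hl).2 h] at hf
    cases hf

/-- Cell and state reveal a newbie's release round; ants on duty for different layers are separated
by the order of claims, and each layer has one owner. -/
theorem same_ant (H : Inv r t) (hr : Function.Injective r) {i j : Fin k} (hi : Active r t i)
    (hj : Active r t j) (hp : (run syncAnt r t).pos i = (run syncAnt r t).pos j)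
    (hq : (run syncAnt r t).state i = (run syncAnt r t).state j) : i = j := by
  have h1 := H.ant_of_active hi
  have h2 := H.ant_of_active hj
  rw [← hp, ← hq] at h2
  rcases h1 with h1 | ⟨s, l, hs, hl, h1⟩ <;> rcases h2 with h2 | ⟨s', l', hs', hl', h2⟩
  · have := h1.unique h2
    exact hr (by omega)
  · exact (not_newbieAt_of_dutyAt h2 h1).elim
  · exact (not_newbieAt_of_dutyAt h1 h2).elim
  · rcases lt_trichotomy l l' with h | rfl | h
    · have := H.claims_add_le hs hs' hl hl' h.le
      exact (h1.unique (s := s) (s' := s') h (by omega) (by ring) h2).elim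
    · exact (H.unique s i s' j l hs hs' hl hl').2
    · have := H.claims_add_le hs' hs hl' hl h.le
      exact (h2.unique (s := s') (s' := s) h (by omega) (by ring) h1).elim

theorem claims_now_unique (H : Inv r t) (hr : Function.Injective r) {i j : Fin k} {l : ℤ}
    (hi : Claims r t i l) (hj : Claims r t j l) : i = j := by
  have h1 := H.ray i
  have h2 := H.ray j
  obtain ⟨ha, hp, hq⟩ := hi
  obtain ⟨ha', hp', hq'⟩ := hj
  rw [hp] at h1
  rw [hp'] at h2
  rcases hq with hq | ⟨hq, -⟩ <;> rcases hq' with hq' | ⟨hq', -⟩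
  · exact H.same_ant hr ha ha' (hp.trans hp'.symm) (hq.trans hq'.symm)
  · rw [hq] at h1
    exact absurd hp' (h1.2.2.2 j hq')
  · rw [hq'] at h2
    exact absurd hp (h2.2.2.2 i hq)
  · exact H.same_ant hr ha ha' (hp.trans hp'.symm) (hq.trans hq'.symm)

/-- The first case, a mark on the eastern ray, is the only emission that precedes the claim of its
layer; the others are dated exactly by the claim. -/
theorem emits_cases (H : Inv r t) {i : Fin k} {x y : ℤ} (hi : Emits r t i)
    (hp : (run syncAnt r t).pos i = (x, y)) :
    (((run syncAnt r t).state i = newbieRay ∨ (run syncAnt r t).state i = veteranRay) ∧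
        y = 0 ∧ 1 ≤ x ∧ (run syncAnt r t).pher (x, 0) = false) ∨
      (Claims r t i x ∧ y = 1) ∨
      (∃ s d, s < t ∧ Claims r s i d ∧ 1 ≤ d ∧ x = 0 ∧ y = -d ∧ (t : ℤ) = s + 1 + 2 * d) ∨
      (∃ s d, s < t ∧ Claims r s i d ∧ 1 ≤ d ∧ x = -d ∧ y = 0 ∧ (t : ℤ) = s + 1 + 4 * d) ∨
      (∃ s d, s < t ∧ Claims r s i d ∧ 1 ≤ d ∧ x = 0 ∧ y = d ∧ (t : ℤ) = s + 1 + 6 * d) := by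
  obtain ⟨ha, he⟩ := hi
  rcases H.ant_of_active ha with h | ⟨s, l, hs, hl, h⟩
  · rw [hp] at he h
    cases hq : (run syncAnt r t).state i <;> rw [hq] at he h <;> simp only [NewbieAt] at h
    case newbieEast => simp [syncAct] at he
    case newbieRay =>
      obtain ⟨rfl, h1, -⟩ := h
      left
      exact ⟨Or.inl rfl, rfl, h1, by simpa [syncAct] using he⟩
    case newbieIdle => simp [syncAct] at he
    case newbieCheck =>
      obtain ⟨rfl, h1, -⟩ := h
      refine Or.inr (Or.inl ⟨⟨ha, hp, Or.inr ⟨hq, ?_⟩⟩, rfl⟩)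
      by_contra hc
      rw [Bool.not_eq_false] at hc
      simp [syncAct, hc] at he
  · rw [hp] at he h
    have hl1 := (H.pred s i l hs hl).1
    have hsn := H.senses hs hl h
    cases hq : (run syncAnt r t).state i <;> rw [hq] at he h hsn
    case veteranRay =>
      obtain ⟨rfl, h1, -⟩ := h
      left
      refine ⟨Or.inr rfl, rfl, h1, ?_⟩
      by_contra hc
      rw [Bool.not_eq_false] at hc
      simp [syncAct, hc] at he
    case veteranNorth =>
      obtain ⟨rfl, h1, -⟩ := h
      exact Or.inr (Or.inl ⟨⟨ha, hp, Or.inl hq⟩, rfl⟩)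
    all_goals
      cases hb : (run syncAnt r t).pher (x, y) <;> rw [hb] at he hsn <;>
      simp [syncAct, DutyAt, Senses] at he h hsn
    case southOut.false => exact Or.inr (Or.inr (Or.inl ⟨s, l, hs, hl, hl1, by omega⟩))
    case westOut.false => exact Or.inr (Or.inr (Or.inr (Or.inl ⟨s, l, hs, hl, hl1, by omega⟩)))
    case northOut.false => exact Or.inr (Or.inr (Or.inr (Or.inr ⟨s, l, hs, hl, hl1, by omega⟩)))
    all_goals (split at he <;> simp at he)

theorem emits_south (H : Inv r t) {s : ℕ} {i : Fin k} {d : ℤ} (hi : Claims r s i d)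
    (hd : 1 ≤ d) (ht : (t : ℤ) = s + 1 + 2 * d) :
    Emits r t i ∧ (run syncAnt r t).pos i = (0, -d) := by
  have h := H.duty s i d (by omega) hi (by omega)
  have hs := H.senses (by omega) hi h
  rw [show (t : ℤ) - s - 1 = 2 * d by omega] at h
  obtain ⟨hq, hx, hy⟩ := h.eq_southOut hd
  have hp : (run syncAnt r t).pos i = (0, -d) := Prod.ext hx hy
  rw [hq, hp] at hs
  simp only [Senses, ne_eq, not_true_eq_false, iff_false, Bool.not_eq_true] at hs
  exact ⟨⟨hi.1.mono (by omega), by simp [hq, hp, hs, syncAct]⟩, hp⟩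

theorem emits_west (H : Inv r t) {s : ℕ} {i : Fin k} {d : ℤ} (hi : Claims r s i d)
    (hd : 1 ≤ d) (ht : (t : ℤ) = s + 1 + 4 * d) :
    Emits r t i ∧ (run syncAnt r t).pos i = (-d, 0) := by
  have h := H.duty s i d (by omega) hi (by omega)
  have hs := H.senses (by omega) hi h
  rw [show (t : ℤ) - s - 1 = 4 * d by omega] at h
  obtain ⟨hq, hx, hy⟩ := h.eq_westOut hd
  have hp : (run syncAnt r t).pos i = (-d, 0) := Prod.ext hx hy
  rw [hq, hp] at hs
  simp only [Senses, ne_eq, not_true_eq_false, iff_false, Bool.not_eq_true] at hs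
  exact ⟨⟨hi.1.mono (by omega), by simp [hq, hp, hs, syncAct]⟩, hp⟩

theorem emits_north (H : Inv r t) {s : ℕ} {i : Fin k} {d : ℤ} (hi : Claims r s i d)
    (hd : 1 ≤ d) (ht : (t : ℤ) = s + 1 + 6 * d) :
    Emits r t i ∧ (run syncAnt r t).pos i = (0, d) := by
  have h := H.duty s i d (by omega) hi (by omega)
  have hs := H.senses (by omega) hi h
  rw [show (t : ℤ) - s - 1 = 6 * d by omega] at h
  obtain ⟨hq, hx, hy⟩ := h.eq_northOut hd
  have hp : (run syncAnt r t).pos i = (0, d) := Prod.ext hx hy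
  rw [hq, hp] at hs
  simp only [Senses, ne_eq, not_true_eq_false, iff_false, Bool.not_eq_true] at hs
  exact ⟨⟨hi.1.mono (by omega), by simp [hq, hp, hs, syncAct]⟩, hp⟩

/-! Each field of the invariant is preserved by a round. -/

theorem succ_duty (H : Inv r t) {s : ℕ} {i : Fin k} {l : ℤ} (hs : s < t + 1)
    (hi : Claims r s i l) (ht : ((t + 1 : ℕ) : ℤ) ≤ s + 2 + 15 * l) :
    DutyAt l ((t + 1 : ℕ) - s - 1) ((run syncAnt r (t + 1)).pos i).1
      ((run syncAnt r (t + 1)).pos i).2 ((run syncAnt r (t + 1)).state i) := by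
  rcases Nat.lt_succ_iff_lt_or_eq.1 hs with h | rfl
  · have h1 := H.duty s i l h hi (by push_cast at ht; omega)
    have h2 := H.senses h hi h1
    have ha : Active r t i := hi.1.mono h.le
    rw [run_succ_pos ha, run_succ_state ha]
    rw [show (((t + 1 : ℕ) : ℤ) - s - 1) = (t - s - 1) + 1 by push_cast; ring]
    refine h1.step (H.pred s i l h hi).1 h2 fun hq => ?_
    rw [hq] at h1
    obtain ⟨-, h3, h4⟩ := h1
    push_cast at ht
    omega
  · rw [hi.next.1, hi.next.2]
    have := (H.claims_now hi).1
    refine ⟨rfl, ?_, le_rfl, ?_⟩ <;> push_cast <;> omega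

theorem succ_ant (H : Inv r t) (i : Fin k) :
    (t + 1 ≤ r i ∧ (run syncAnt r (t + 1)).pos i = (0, 0) ∧
        (run syncAnt r (t + 1)).state i = newbieEast) ∨
      (r i ≤ t + 1 ∧ NewbieAt ((t + 1 : ℕ) - r i) ((run syncAnt r (t + 1)).pos i).1
        ((run syncAnt r (t + 1)).pos i).2 ((run syncAnt r (t + 1)).state i)) ∨
      ∃ s l, s < t + 1 ∧ Claims r s i l ∧ DutyAt l ((t + 1 : ℕ) - s - 1)
        ((run syncAnt r (t + 1)).pos i).1 ((run syncAnt r (t + 1)).pos i).2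
        ((run syncAnt r (t + 1)).state i) := by
  by_cases ha : Active r t i
  · have hclaim : ∀ l, Claims r t i l → _ := fun l hl =>
      H.succ_duty (Nat.lt_succ_self t) hl (by have := (H.claims_now hl).1; push_cast; omega)
    right
    rcases H.ant_of_active ha with h | ⟨s, l, hs, hl, h⟩
    · by_cases hq : (run syncAnt r t).state i = newbieCheck ∧
          (run syncAnt r t).pher ((run syncAnt r t).pos i) = false
      · right
        rw [hq.1] at h
        have hp : (run syncAnt r t).pos i = (((run syncAnt r t).pos i).1, 1) :=
          Prod.ext rfl h.1
        have hc : Claims r t i ((run syncAnt r t).pos i).1 :=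
          ⟨ha, hp, Or.inr ⟨hq.1, hp ▸ hq.2⟩⟩
        exact ⟨t, _, Nat.lt_succ_self t, hc, hclaim _ hc⟩
      · left
        refine ⟨le_trans (show r i ≤ t from ha) (Nat.le_succ t), ?_⟩
        rw [run_succ_pos ha, run_succ_state ha,
          show (((t + 1 : ℕ) : ℤ) - r i) = (t - r i) + 1 by push_cast; ring]
        exact h.step hq
    · right
      by_cases hq : (run syncAnt r t).state i = veteranNorth
      · rw [hq] at h
        have hc : Claims r t i ((run syncAnt r t).pos i).1 :=
          ⟨ha, Prod.ext rfl h.1, Or.inl hq⟩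
        exact ⟨t, _, Nat.lt_succ_self t, hc, hclaim _ hc⟩
      · refine ⟨s, l, by omega, hl, ?_⟩
        rw [run_succ_pos ha, run_succ_state ha,
          show (((t + 1 : ℕ) : ℤ) - s - 1) = (t - s - 1) + 1 by push_cast; ring]
        exact h.step (H.pred s i l hs hl).1 (H.senses hs hl h) hq
  · left
    rw [run_succ_pos_of_not ha, run_succ_state_of_not ha]
    exact H.inactive ha

theorem succ_pher_lane (H : Inv r t) {x : ℤ} (hx : 1 ≤ x) :
    (run syncAnt r (t + 1)).pher (x, 1) = true ↔ ClaimedBefore r (t + 1) x := by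
  rw [run_succ_pher, H.pher_lane x hx, claimedBefore_succ]
  refine or_congr_right ⟨?_, fun ⟨i, hi⟩ => ⟨i, hi.emits, hi.2.1⟩⟩
  rintro ⟨i, hi, hp⟩
  rcases H.emits_cases hi hp with h | h | ⟨s, d, h⟩ | ⟨s, d, h⟩ | ⟨s, d, h⟩
  · omega
  · exact ⟨i, h.1⟩
  all_goals omega

theorem succ_pher_south (H : Inv r t) {d : ℤ} (hd : 1 ≤ d) :
    (run syncAnt r (t + 1)).pher (0, -d) = true ↔
      ∃ s i, Claims r s i d ∧ (s : ℤ) + 1 + 2 * d < (t + 1 : ℕ) := by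
  rw [run_succ_pher, H.pher_south d hd]
  constructor
  · rintro (⟨s, i, h1, h2⟩ | ⟨i, hi, hp⟩)
    · exact ⟨s, i, h1, by push_cast; omega⟩
    · rcases H.emits_cases hi hp with h | h | ⟨s, d', h⟩ | ⟨s, d', h⟩ | ⟨s, d', h⟩
      · omega
      · omega
      · obtain rfl : d = d' := by omega
        exact ⟨s, i, h.2.1, by push_cast; omega⟩
      all_goals omega
  · rintro ⟨s, i, h1, h2⟩
    by_cases h : (s : ℤ) + 1 + 2 * d < t
    · exact Or.inl ⟨s, i, h1, h⟩
    · exact Or.inr ⟨i, H.emits_south h1 hd (by push_cast at h2; omega)⟩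

theorem succ_pher_west (H : Inv r t) {d : ℤ} (hd : 1 ≤ d) :
    (run syncAnt r (t + 1)).pher (-d, 0) = true ↔
      ∃ s i, Claims r s i d ∧ (s : ℤ) + 1 + 4 * d < (t + 1 : ℕ) := by
  rw [run_succ_pher, H.pher_west d hd]
  constructor
  · rintro (⟨s, i, h1, h2⟩ | ⟨i, hi, hp⟩)
    · exact ⟨s, i, h1, by push_cast; omega⟩
    · rcases H.emits_cases hi hp with h | h | ⟨s, d', h⟩ | ⟨s, d', h⟩ | ⟨s, d', h⟩
      · omega
      · omega
      · omega
      · obtain rfl : d = d' := by omega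
        exact ⟨s, i, h.2.1, by push_cast; omega⟩
      · omega
  · rintro ⟨s, i, h1, h2⟩
    by_cases h : (s : ℤ) + 1 + 4 * d < t
    · exact Or.inl ⟨s, i, h1, h⟩
    · exact Or.inr ⟨i, H.emits_west h1 hd (by push_cast at h2; omega)⟩

theorem succ_pher_north (H : Inv r t) {d : ℤ} (hd : 1 ≤ d) :
    (run syncAnt r (t + 1)).pher (0, d) = true ↔
      ∃ s i, Claims r s i d ∧ (s : ℤ) + 1 + 6 * d < (t + 1 : ℕ) := by
  rw [run_succ_pher, H.pher_north d hd]
  constructor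
  · rintro (⟨s, i, h1, h2⟩ | ⟨i, hi, hp⟩)
    · exact ⟨s, i, h1, by push_cast; omega⟩
    · rcases H.emits_cases hi hp with h | h | ⟨s, d', h⟩ | ⟨s, d', h⟩ | ⟨s, d', h⟩
      · omega
      · have := (H.claims_now h.1).1
        omega
      · omega
      · omega
      · obtain rfl : d = d' := by omega
        exact ⟨s, i, h.2.1, by push_cast; omega⟩
  · rintro ⟨s, i, h1, h2⟩
    by_cases h : (s : ℤ) + 1 + 6 * d < t
    · exact Or.inl ⟨s, i, h1, h⟩
    · exact Or.inr ⟨i, H.emits_north h1 hd (by push_cast at h2; omega)⟩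

theorem succ_ray_pher (H : Inv r t) {x : ℤ} (h : ClaimedBefore r (t + 1) x) :
    (run syncAnt r t).pher (x, 0) = true := by
  rcases claimedBefore_succ.1 h with h | ⟨i, hi⟩
  · exact H.ray_pher x h
  · exact (H.claims_now hi).2.2.2

theorem succ_pher_only (H : Inv r t) {x y : ℤ} (h : (run syncAnt r (t + 1)).pher (x, y) = true) :
    (x = 0 ∧ y ≠ 0) ∨ (y = 0 ∧ x ≠ 0) ∨ (y = 1 ∧ 1 ≤ x) := by
  rcases run_succ_pher.1 h with h | ⟨i, hi, hp⟩
  · exact H.pher_only x y h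
  · rcases H.emits_cases hi hp with h | h | ⟨s, d, h⟩ | ⟨s, d, h⟩ | ⟨s, d, h⟩
    · omega
    · have := (H.claims_now h.1).1
      omega
    all_goals omega

/-- An idling newbie checks in the next round, and either claims or finds the column already
claimed. -/
theorem claimedBefore_of_pher_ray (H : Inv r t) {x : ℤ} (hx : 1 ≤ x)
    (h : (run syncAnt r t).pher (x, 0) = true) : ClaimedBefore r (t + 2) x := by
  rcases H.pher_ray x hx h with h | ⟨i, hq, hp⟩
  · exact h.mono (by omega)
  · have ha : Active r t i := by
      by_contra ha
      have := (H.inactive ha).2.2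
      simp [hq] at this
    have hq' : (run syncAnt r (t + 1)).state i = newbieCheck := by
      simp [run_succ_state ha, hq, syncAct]
    have hp' : (run syncAnt r (t + 1)).pos i = (x, 1) := by
      simp [run_succ_pos ha, hq, hp, syncAct, Move.apply]
    cases hb : (run syncAnt r (t + 1)).pher (x, 1)
    · exact ⟨t + 1, by omega, i, ha.mono (by omega), hp', Or.inr ⟨hq', hb⟩⟩
    · exact ((H.succ_pher_lane hx).1 hb).mono (by omega)

theorem succ_pher_ray (H : Inv r t) {x : ℤ} (hx : 1 ≤ x)
    (h : (run syncAnt r (t + 1)).pher (x, 0) = true) : ClaimedBefore r (t + 1 + 1) x ∨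
      ∃ i, (run syncAnt r (t + 1)).state i = newbieIdle ∧
        (run syncAnt r (t + 1)).pos i = (x, 1) := by
  rcases run_succ_pher.1 h with h | ⟨i, hi, hp⟩
  · exact Or.inl (H.claimedBefore_of_pher_ray hx h)
  · rcases H.emits_cases hi hp with ⟨h1 | h1, -, -, h2⟩ | h | ⟨s, d, h⟩ | ⟨s, d, h⟩ | ⟨s, d, h⟩
    · right
      exact ⟨i, by simp [run_succ_state hi.1, h1, syncAct],
        by simp [run_succ_pos hi.1, h1, hp, syncAct, Move.apply]⟩
    · left
      exact ⟨t + 1, by omega, i, hi.1.mono (by omega),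
        by simp [run_succ_pos hi.1, h1, hp, h2, syncAct, Move.apply],
        Or.inl (by simp [run_succ_state hi.1, h1, hp, h2, syncAct])⟩
    all_goals omega

theorem idle_of_succ_check {j : Fin k} (H : Inv r t)
    (hj : (run syncAnt r (t + 1)).state j = newbieCheck) :
    (run syncAnt r t).state j = newbieIdle ∧
      (run syncAnt r (t + 1)).pos j = (run syncAnt r t).pos j := by
  by_cases ha : Active r t j
  · rw [run_succ_state ha] at hj
    rw [run_succ_pos ha]
    cases hq : (run syncAnt r t).state j <;>
      cases hb : (run syncAnt r t).pher ((run syncAnt r t).pos j) <;>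
      rw [hq, hb] at hj <;> simp [syncAct] at hj
    case newbieIdle.false => simp [syncAct, Move.apply]
    case newbieIdle.true => simp [syncAct, Move.apply]
    all_goals (split at hj <;> simp at hj)
  · rw [run_succ_state_of_not ha, (H.inactive ha).2.2] at hj
    cases hj

theorem succ_ray (H : Inv r t) (i : Fin k) :
    RayAt r (t + 1) ((run syncAnt r (t + 1)).pos i).1 ((run syncAnt r (t + 1)).state i) := by
  by_cases ha : Active r t i
  swap
  · rw [run_succ_pos_of_not ha, run_succ_state_of_not ha, (H.inactive ha).2.1,
      (H.inactive ha).2.2]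
    simp [RayAt]
  have hant := H.ant_of_active ha
  have hray := H.ray i
  have hem : Emits r t i → (run syncAnt r (t + 1)).pher ((run syncAnt r t).pos i) = true :=
    fun h => run_succ_pher.2 (Or.inr ⟨i, h, rfl⟩)
  rw [Emits] at hem
  rw [run_succ_pos ha, run_succ_state ha]
  obtain ⟨⟨x, y⟩, hp⟩ : ∃ c, (run syncAnt r t).pos i = c := ⟨_, rfl⟩
  rw [hp] at hant hray hem ⊢
  have hpm : ∀ c, (run syncAnt r t).pher c = true → (run syncAnt r (t + 1)).pher c = true :=
    fun c => pher_mono (Nat.le_succ t)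
  cases hq : (run syncAnt r t).state i <;> rw [hq] at hant hray hem
  case newbieEast =>
    simp only [RayAt, syncAct, Move.apply] at hray ⊢
    intro h
    rw [add_sub_cancel_right]
    exact (hray (by omega)).mono (Nat.le_succ t)
  case newbieRay =>
    simp only [NewbieAt, DutyAt, and_false, exists_false, or_false] at hant
    obtain ⟨rfl, hx, -⟩ := hant
    simp only [RayAt, syncAct, Move.apply] at hray ⊢
    refine ⟨fun h => (hray h).mono (Nat.le_succ t), ?_⟩
    cases hb : (run syncAnt r t).pher (x, 0)
    · exact hem ⟨ha, by simp [hb, syncAct]⟩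
    · exact hpm _ hb
  case newbieIdle =>
    simp only [RayAt, syncAct, Move.apply] at hray ⊢
    exact ⟨fun h => (hray.1 h).mono (Nat.le_succ t), hpm _ hray.2⟩
  case newbieCheck =>
    simp only [NewbieAt, DutyAt, and_false, exists_false, or_false] at hant
    obtain ⟨rfl, hx, -⟩ := hant
    cases hb : (run syncAnt r t).pher (x, 1)
    · simp [syncAct, RayAt]
    · simp only [RayAt, syncAct, Move.apply]
      exact fun _ => ((H.pher_lane x hx).1 hb).mono (Nat.le_succ t)
  case veteranRay =>
    have hant : y = 0 ∧ 1 ≤ x := by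
      rcases hant with h | ⟨s, l, -, -, h⟩
      · exact h.elim
      · exact ⟨h.1, h.2.1⟩
    obtain ⟨rfl, hx⟩ := hant
    cases hb : (run syncAnt r t).pher (x, 0)
    · simp only [RayAt, syncAct, Move.apply] at hray ⊢
      refine ⟨hray, hem ⟨ha, by simp [hb, syncAct]⟩, fun h => ?_, fun j hj hpj => ?_⟩
      · simp [H.succ_ray_pher h] at hb
      -- A newbie about to check there is idling there now, so the ray cell below would already be
      -- marked.
      · obtain ⟨h1, h2⟩ := H.idle_of_succ_check hj
        have h3 := H.ray j
        rw [h1, ← h2, hpj] at h3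
        simp [h3.2] at hb
    · simp only [RayAt, syncAct, Move.apply]
      intro _
      rw [add_sub_cancel_right]
      exact H.claimedBefore_of_pher_ray hx hb
  case home =>
    have hant : x = 0 := by
      rcases hant with h | ⟨s, l, -, -, h⟩
      · exact h.elim
      · exact h.1
    subst hant
    cases hb : (run syncAnt r t).pher (0, y) <;> simp [RayAt, syncAct, Move.apply]
  case zagES b =>
    cases b <;> cases hb : (run syncAnt r t).pher (x, y) <;> simp [RayAt, syncAct]
  all_goals
    cases hb : (run syncAnt r t).pher (x, y) <;> simp [RayAt, syncAct]

theorem succ (H : Inv r t) (hr : Function.Injective r) : Inv r (t + 1) where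
  ant := H.succ_ant
  duty _ _ _ := H.succ_duty
  unique s i s' j l hs hs' hi hj := by
    rcases Nat.lt_succ_iff_lt_or_eq.1 hs with h | rfl <;>
      rcases Nat.lt_succ_iff_lt_or_eq.1 hs' with h' | rfl
    · exact H.unique s i s' j l h h' hi hj
    · exact absurd ⟨s, h, i, hi⟩ (H.claims_now hj).2.2.1
    · exact absurd ⟨s', h', j, hj⟩ (H.claims_now hi).2.2.1
    · exact ⟨rfl, H.claims_now_unique hr hi hj⟩
  pred s i l hs hi := by
    rcases Nat.lt_succ_iff_lt_or_eq.1 hs with h | rfl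
    · exact H.pred s i l h hi
    · exact ⟨(H.claims_now hi).1, (H.claims_now hi).2.1⟩
  ray := H.succ_ray
  pher_lane _ := H.succ_pher_lane
  pher_south _ := H.succ_pher_south
  pher_west _ := H.succ_pher_west
  pher_north _ := H.succ_pher_north
  pher_ray _ := H.succ_pher_ray
  ray_pher _ h := pher_mono (Nat.le_succ t) (H.succ_ray_pher h)
  pher_only _ _ := H.succ_pher_only

end Inv

/-! ### Consequences of the invariant for the whole execution. -/

theorem inv_run (hr : Function.Injective r) (t : ℕ) : Inv r t := by
  induction t with
  | zero => exact inv_zero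
  | succ t ih => exact ih.succ hr

theorem Claims.unique (hr : Function.Injective r) {s s' : ℕ} {i j : Fin k} {l : ℤ}
    (h : Claims r s i l) (h' : Claims r s' j l) : s = s' ∧ i = j :=
  (inv_run hr (max s s' + 1)).unique s i s' j l (by omega) (by omega) h h'

theorem Claims.one_le (hr : Function.Injective r) {s : ℕ} {i : Fin k} {l : ℤ}
    (h : Claims r s i l) : 1 ≤ l :=
  ((inv_run hr s).claims_now h).1

theorem Claims.add_le (hr : Function.Injective r) {s s' : ℕ} {i j : Fin k} {l l' : ℤ}
    (h : Claims r s i l) (h' : Claims r s' j l') (hl : l ≤ l') : (s : ℤ) + (l' - l) ≤ s' :=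
  (inv_run hr (max s s' + 1)).claims_add_le (by omega) (by omega) h h' hl

theorem Claims.dutyAt (hr : Function.Injective r) {s : ℕ} {i : Fin k} {l : ℤ}
    (h : Claims r s i l) (a : ℕ) (ha : (a : ℤ) ≤ 15 * l + 1) :
    DutyAt l a ((run syncAnt r (s + 1 + a)).pos i).1 ((run syncAnt r (s + 1 + a)).pos i).2
      ((run syncAnt r (s + 1 + a)).state i) := by
  have := (inv_run hr (s + 1 + a)).duty s i l (by omega) h (by push_cast; omega)
  rwa [show (((s + 1 + a : ℕ) : ℤ) - s - 1) = a by push_cast; ring] at this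

theorem not_collide (hr : Function.Injective r) (t : ℕ) (i j : Fin k) :
    ¬ Collide syncAnt r t i j := fun ⟨hne, hi, hj, hp, hq⟩ =>
  hne ((inv_run hr t).same_ant hr hi hj hp hq)

/-- An ant on the northern ray senses no pheromone only at its own layer, 6l rounds into its duty.
-/
theorem StartsLayer.claims (hr : Function.Injective r) {t : ℕ} {i : Fin k} {l : ℕ}
    (h : StartsLayer r t i l) : ∃ s, Claims r s i l ∧ t = s + 1 + 6 * l := by
  obtain ⟨ha, hq, hp, hb⟩ := h
  have H := inv_run hr t
  rcases H.ant_of_active ha with h | ⟨s, l', hs, hl, h⟩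
  · rw [hq] at h
    exact h.elim
  · have h1 := H.senses hs hl h
    rw [hp, hq] at h h1
    simp only [Senses, hb, DutyAt] at h h1
    have h2 : (l : ℤ) = l' := by simpa using h1
    subst h2
    exact ⟨s, hl, by omega⟩

/-- The four cases are the sides of the layer. Its cells are met after the second step of each pair
(the northern corner first in `northOut`); the first steps lie on layer l + 1 and are excluded by
parity. -/
theorem DutyAt.eq_cell {l a x y x' y' : ℤ} {q : SyncState} (h : DutyAt l a x y q)
    (hc : (0 ≤ x' ∧ y' = l - x' ∧ 0 ≤ y' ∧ a = 6 * l + 2 * x') ∨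
      (0 ≤ x' ∧ y' = x' - l ∧ y' ≤ 0 ∧ a = 10 * l - 2 * x') ∨
      (x' ≤ 0 ∧ y' = -l - x' ∧ y' ≤ 0 ∧ a = 10 * l - 2 * x') ∨
      (x' ≤ 0 ∧ y' = l + x' ∧ 0 ≤ y' ∧ a = 14 * l + 2 * x')) (hl : 1 ≤ l) :
    x = x' ∧ y = y' := by
  cases q <;> simp [DutyAt] at h <;> omega

/-- An ant that claims layer `l` visits all its cells between `6 * l` and `14 * l` rounds later. -/
theorem Claims.explores (hr : Function.Injective r) {s : ℕ} {i : Fin k} {l : ℕ}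
    (h : Claims r s i l) {c : Cell} (hc : dist c = l) :
    ∃ u, s + 1 + 6 * l ≤ u ∧ u ≤ s + 1 + 14 * l ∧ (run syncAnt r u).pos i = c := by
  obtain ⟨x, y⟩ := c
  have hc' : x.natAbs + y.natAbs = l := hc
  have hl := h.one_le hr
  obtain ⟨a, ha1, ha2, ha⟩ : ∃ a : ℕ, 6 * l ≤ a ∧ a ≤ 14 * l ∧
      ((0 ≤ x ∧ y = l - x ∧ 0 ≤ y ∧ (a : ℤ) = 6 * l + 2 * x) ∨
      (0 ≤ x ∧ y = x - l ∧ y ≤ 0 ∧ (a : ℤ) = 10 * l - 2 * x) ∨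
      (x ≤ 0 ∧ y = -l - x ∧ y ≤ 0 ∧ (a : ℤ) = 10 * l - 2 * x) ∨
      (x ≤ 0 ∧ y = l + x ∧ 0 ≤ y ∧ (a : ℤ) = 14 * l + 2 * x)) := by
    rcases le_total 0 x with hx | hx <;> rcases le_total 0 y with hy | hy
    · exact ⟨(6 * l + 2 * x).toNat, by omega, by omega, by omega⟩
    · exact ⟨(10 * l - 2 * x).toNat, by omega, by omega, by omega⟩
    · exact ⟨(14 * l + 2 * x).toNat, by omega, by omega, by omega⟩
    · exact ⟨(10 * l - 2 * x).toNat, by omega, by omega, by omega⟩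
  obtain ⟨h1, h2⟩ := (h.dutyAt hr a (by omega)).eq_cell ha hl
  exact ⟨s + 1 + a, by omega, by omega, Prod.ext h1 h2⟩

/-! ### The time until a layer is claimed -/

open Classical in
variable (r) in
/-- The layers below `D` that ant `i` has claimed in the rounds before `t`. -/
noncomputable def claimedLayers (D t : ℕ) (i : Fin k) : Finset ℕ :=
  (Finset.Ico 1 D).filter fun l => ∃ s < t, Claims r s i l

theorem lt_of_claimedBefore (hr : Function.Injective r) {t D : ℕ} (hD : 1 ≤ D)
    (hn : ¬ ClaimedBefore r t D) {l : ℤ} (h : ClaimedBefore r t l) : l < D := by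
  by_contra hl
  exact hn ((inv_run hr t).ClaimedBefore_of_le le_rfl h (by omega) (by omega))

/-- Strong induction jumping back to the claim behind the current duty. Since `RayAt` confines ants
to columns up to D, the newbie phase lasts at most 4D rounds and a duty for a layer below D at most
16D. -/
theorem le_add_card_claimedLayers (hr : Function.Injective r) {D R : ℕ} (hD : 1 ≤ D)
    {i : Fin k} (hi : r i ≤ R) (t : ℕ) (hn : ¬ ClaimedBefore r (t + 1) D) :
    t ≤ R + 17 * D * ((claimedLayers r D t i).card + 1) := by
  induction t using Nat.strong_induction_on with
  | _ t ih =>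
  by_cases ht : t ≤ R
  · omega
  have H := inv_run hr t
  have ha : Active r t i := show r i ≤ t by omega
  have hlt : ∀ {l : ℤ}, ClaimedBefore r (t + 1) l → l < D := lt_of_claimedBefore hr hD hn
  have hlt' : ∀ {l : ℤ}, ClaimedBefore r t l → l < D := fun h => hlt (h.mono (Nat.le_succ t))
  have hray := H.ray i
  rcases H.ant_of_active ha with h | ⟨s, l, hs, hl, h⟩
  · have hx : ((run syncAnt r t).pos i).1 ≤ D := by
      by_contra hx
      cases hq : (run syncAnt r t).state i <;> rw [hq] at h hray <;>
        simp only [NewbieAt, RayAt] at h hray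
      · have := hlt' (hray (by omega)); omega
      · have := hlt' (hray (by omega)); omega
      · have := hlt' (hray.1 (by omega)); omega
      · have := hlt' (hray.1 (by omega)); omega
    have h4 : (t : ℤ) - r i ≤ 4 * D := by
      cases hq : (run syncAnt r t).state i <;> rw [hq] at h <;> simp only [NewbieAt] at h <;> omega
    have : 17 * D * 1 ≤ 17 * D * ((claimedLayers r D t i).card + 1) :=
      Nat.mul_le_mul_left _ (by omega)
    omega
  · have hlD : l < D := hlt' ⟨s, hs, i, hl⟩
    have hl1 := hl.one_le hr
    have h16 : (t : ℤ) - s - 1 ≤ 16 * D - 1 := by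
      cases hq : (run syncAnt r t).state i <;> rw [hq] at h hray
      case veteranRay =>
        obtain ⟨-, h1, h2⟩ := h
        by_contra hx
        have := hlt (hray (by omega))
        omega
      case veteranNorth =>
        obtain ⟨-, h1, h2⟩ := h
        by_contra hx
        have := hlt' (hray.1 (by omega))
        omega
      all_goals first
        | exact False.elim h
        | (simp only [DutyAt] at h; omega)
    have hs' := ih s hs fun hc => hn (hc.mono (by omega))
    have hcard : (claimedLayers r D s i).card + 1 ≤ (claimedLayers r D t i).card := by
      apply Finset.card_lt_card
      rw [Finset.ssubset_iff_of_subset]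
      · refine ⟨l.toNat, ?_, ?_⟩
        · simp only [claimedLayers, Finset.mem_filter, Finset.mem_Ico]
          exact ⟨by omega, s, hs, by rwa [Int.toNat_of_nonneg (by omega)]⟩
        · simp only [claimedLayers, Finset.mem_filter, Finset.mem_Ico, not_and]
          rintro - ⟨u, hu, hc⟩
          rw [Int.toNat_of_nonneg (by omega)] at hc
          have := (hc.unique hr hl).1
          omega
      · intro m hm
        simp only [claimedLayers, Finset.mem_filter] at hm ⊢
        obtain ⟨h1, u, hu, hc⟩ := hm
        exact ⟨h1, u, by omega, hc⟩
    have : 17 * D * ((claimedLayers r D s i).card + 1 + 1) ≤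
        17 * D * ((claimedLayers r D t i).card + 1) :=
      Nat.mul_le_mul_left _ (by omega)
    rw [mul_add _ _ 1] at this
    omega

/-- Each layer has one owner, so these sets are disjoint. -/
theorem sum_card_claimedLayers_le (hr : Function.Injective r) (D t : ℕ) (A : Finset (Fin k)) :
    ∑ i ∈ A, (claimedLayers r D t i).card ≤ D - 1 := by
  classical
  rw [← Finset.card_biUnion, ← Nat.card_Ico 1 D]
  · apply Finset.card_le_card
    intro l hl
    simp only [claimedLayers, Finset.mem_biUnion, Finset.mem_filter] at hl
    obtain ⟨i, -, h, -⟩ := hl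
    exact h
  · intro i _ j _ hij
    rw [Function.onFun, Finset.disjoint_left]
    intro l hi hj
    simp only [claimedLayers, Finset.mem_filter] at hi hj
    obtain ⟨-, s, -, hs⟩ := hi
    obtain ⟨-, s', -, hs'⟩ := hj
    exact hij (hs.unique hr hs').2

/-- Pigeonhole: otherwise every ant of A would own at least q + 1 layers below D, more than D - 1 in
total. -/
theorem exists_claims_le (hr : Function.Injective r) {D R : ℕ} (hD : 1 ≤ D)
    {A : Finset (Fin k)} (hA : A.Nonempty) (hR : ∀ i ∈ A, r i ≤ R) :
    ∃ s i, Claims r s i D ∧ s ≤ R + 17 * D * ((D - 1) / A.card + 1) + 1 := by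
  set q := (D - 1) / A.card with hq
  by_contra hcon
  push Not at hcon
  -- One `+ 1` makes the time exceed the bound for q layers; the other is the shift in
  -- `le_add_card_claimedLayers`.
  have hn : ¬ ClaimedBefore r (R + 17 * D * (q + 1) + 1 + 1) D := by
    rintro ⟨s, hs, i, hi⟩
    have := hcon s i hi
    omega
  have hcard : ∀ i ∈ A, q + 1 ≤
      (claimedLayers r D (R + 17 * D * (q + 1) + 1) i).card := by
    intro i hi
    have h := le_add_card_claimedLayers hr hD (hR i hi) _ hn
    by_contra hlt
    have : 17 * D * ((claimedLayers r D (R + 17 * D * (q + 1) + 1) i).card + 1) ≤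
        17 * D * (q + 1) := Nat.mul_le_mul_left _ (by omega)
    omega
  have h1 := Finset.card_nsmul_le_sum A _ _ hcard
  have h2 := sum_card_claimedLayers_le hr D (R + 17 * D * (q + 1) + 1) A
  have h3 := Nat.lt_mul_div_succ (D - 1) hA.card_pos
  rw [← hq] at h3
  rw [smul_eq_mul] at h1
  omega

/-! ### The number of emissions -/

/-- Only `veteranNorth` can emit on a marked cell, and that emission is a claim, hence unique. -/
theorem Emits.unique (hr : Function.Injective r) {t t' : ℕ} {i j : Fin k}
    (h : Emits r t i) (h' : Emits r t' j)
    (hq : (run syncAnt r t).state i = (run syncAnt r t').state j)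
    (hp : (run syncAnt r t).pos i = (run syncAnt r t').pos j) : t = t' ∧ i = j := by
  wlog hle : t ≤ t' generalizing t t' i j
  · have := this h' h hq.symm hp.symm (by omega)
    exact ⟨this.1.symm, this.2.symm⟩
  rcases hle.eq_or_lt with rfl | hlt
  · exact ⟨rfl, (inv_run hr t).same_ant hr h.1 h'.1 hp hq⟩
  · have hb : (run syncAnt r t').pher ((run syncAnt r t').pos j) = true :=
      pher_mono hlt (run_succ_pher.2 (Or.inr ⟨i, h, hp⟩))
    have he := h'.2
    rw [hb] at he
    have hv : (run syncAnt r t').state j = veteranNorth := by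
      cases hs : (run syncAnt r t').state j <;> rw [hs] at he <;> simp [syncAct] at he ⊢
      all_goals (split at he <;> simp at he)
    have hy : ((run syncAnt r t').pos j).2 = 1 := by
      rcases (inv_run hr t').ant_of_active h'.1 with h1 | ⟨s, l, -, -, h1⟩
      · rw [hv] at h1
        exact h1.elim
      · rw [hv] at h1
        exact h1.1
    have hj : (run syncAnt r t').pos j = (((run syncAnt r t').pos j).1, 1) := Prod.ext rfl hy
    exact Claims.unique hr (l := ((run syncAnt r t').pos j).1)
      ⟨h.1, hp.trans hj, Or.inl (hq.trans hv)⟩ ⟨h'.1, hj, Or.inl hv⟩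

/-- The cells in which the ants that are busy with layer `n` emit. -/
def layerCells (n : ℕ) : Finset Cell := 
  {((n : ℤ), 0), ((n : ℤ), 1), (0, -(n : ℤ)), (-(n : ℤ), 0), (0, (n : ℤ))}

/-- One round per layer means that no layer above D + 14D is claimed by round t; a ray mark can be
one column further. -/
theorem emits_mem_layerCells (hr : Function.Injective r) {D s t : ℕ} {i j : Fin k}
    (hs : Claims r s i D) (ht : t ≤ s + 14 * D) (h : Emits r t j) :
    ∃ n < 15 * D + 2, (run syncAnt r t).pos j ∈ layerCells n := by
  have H := inv_run hr t
  have hD := hs.one_le hr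
  have hle : ∀ {u m l}, u ≤ t → Claims r u m l → l ≤ 15 * D := by
    intro u m l hu hl
    by_contra hlt
    have := hs.add_le hr hl (by omega)
    omega
  obtain ⟨⟨x, y⟩, hp⟩ : ∃ c, (run syncAnt r t).pos j = c := ⟨_, rfl⟩
  rw [hp]
  rcases H.emits_cases h hp with ⟨hq, rfl, h1, -⟩ | ⟨hc, rfl⟩ | ⟨u, d, hu, hc, h1, rfl, rfl, -⟩ |
    ⟨u, d, hu, hc, h1, rfl, rfl, -⟩ | ⟨u, d, hu, hc, h1, rfl, hy, -⟩
  · have hx : 2 ≤ x → ClaimedBefore r (t + 1) (x - 1) := fun h2 => by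
      have hray := H.ray j
      rw [hp] at hray
      rcases hq with hq | hq
      · rw [hq] at hray
        exact ClaimedBefore.mono (hray h2) (Nat.le_succ t)
      · rw [hq] at hray
        exact hray h2
    refine ⟨x.toNat, ?_, by simp [layerCells, Int.toNat_of_nonneg (show 0 ≤ x by omega)]⟩
    by_contra h2
    obtain ⟨u, hu, m, hm⟩ := hx (by omega)
    have := hle (by omega) hm
    omega
  · have := hle le_rfl hc
    have := hc.one_le hr
    exact ⟨x.toNat, by omega, by simp [layerCells, Int.toNat_of_nonneg (show 0 ≤ x by omega)]⟩
  all_goals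
    have := hle hu.le hc
    exact ⟨d.toNat, by omega, by simp [layerCells, Int.toNat_of_nonneg (show 0 ≤ d by omega), *]⟩

theorem pheromonesEmitted_le (hr : Function.Injective r) {D s T : ℕ} {i : Fin k}
    (hs : Claims r s i D) (hT : T ≤ s + 1 + 14 * D) :
    pheromonesEmitted syncAnt r T ≤ Fintype.card SyncState * ((15 * D + 2) * 5) := by
  classical
  rw [pheromonesEmitted, ← Finset.card_sigma]
  set S : Finset Cell := (Finset.range (15 * D + 2)).biUnion layerCells with hS
  have hcS : S.card ≤ (15 * D + 2) * 5 := by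
    refine (Finset.card_biUnion_le_card_mul _ layerCells 5 fun n _ => Finset.card_le_five).trans ?_
    rw [Finset.card_range]
  calc _ ≤ ((Finset.univ : Finset SyncState) ×ˢ S).card := by
        apply Finset.card_le_card_of_injOn
          (fun p => ((run syncAnt r p.1).state p.2, (run syncAnt r p.1).pos p.2))
        · rintro ⟨t, j⟩ h
          simp only [Finset.coe_sigma, Set.mem_sigma_iff, Finset.coe_filter, Finset.mem_coe,
            Finset.mem_range, Finset.mem_univ, true_and, Set.mem_ofPred_eq] at h
          obtain ⟨n, hn, hc⟩ := emits_mem_layerCells hr hs (by omega) (j := j) (t := t) h.2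
          simp only [Finset.coe_product, Set.mem_prod, Finset.mem_coe, Finset.mem_univ, true_and,
            hS, Finset.mem_biUnion, Finset.mem_range]
          exact ⟨n, hn, hc⟩
        · rintro ⟨t, j⟩ h ⟨t', j'⟩ h' heq
          simp only [Finset.coe_sigma, Set.mem_sigma_iff, Finset.coe_filter, Finset.mem_coe,
            Finset.mem_range, Finset.mem_univ, true_and, Set.mem_ofPred_eq] at h h'
          simp only [Prod.mk.injEq] at heq
          obtain ⟨rfl, rfl⟩ := Emits.unique hr (t := t) (t' := t') (i := j) (j := j') h.2 h'.2
            heq.1 heq.2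
          rfl
    _ ≤ _ := by
        rw [Finset.card_product, Finset.card_univ]
        exact Nat.mul_le_mul_left _ hcS

/-! ### Assembling the bounds. -/

theorem pos_release (hr : Function.Injective r) (i : Fin k) :
    (run syncAnt r (r i)).pos i = nest := by
  rcases (inv_run hr (r i)).ant i with h | ⟨-, h⟩ | ⟨s, l, hs, hl, -⟩
  · exact h.2.1
  · rw [sub_self] at h
    cases hq : (run syncAnt r (r i)).state i <;> rw [hq] at h <;> simp only [NewbieAt] at h
    case newbieEast => exact Prod.ext (show _ = (0 : ℤ) by omega) h.1
    all_goals omega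
  · have : r i ≤ s := hl.1
    omega

/-- The treasure is found soon after its layer has been claimed. -/
theorem exists_foundAt_le (hr : StrictMono r) {D : ℕ} (hD : 1 ≤ D) {m : Fin k}
    (hm : (m : ℕ) = min k D - 1) {c : Cell} (hc : dist c = D) : ∃ s i T, Claims r s i D ∧ FoundAt syncAnt r c T ∧
      T ≤ s + 1 + 14 * D ∧
      s ≤ r m + 17 * D * ((D - 1) / min k D + 1) + 1 := by
  have hk : 0 < k := m.pos
  have hmk : min k D ≤ k := min_le_left _ _
  -- The first min(k, D) ants, the last of which is `m`.
  set A : Finset (Fin k) := Finset.univ.map (Fin.castLEEmb hmk) with hA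
  have hcard : A.card = min k D := by simp [hA]
  obtain ⟨s, i, hs, hle⟩ := exists_claims_le hr.injective hD
    (R := r m) (A := A)
    (Finset.card_pos.1 (by rw [hcard]; omega)) (by
      intro i hi
      rw [hA, Finset.mem_map] at hi
      obtain ⟨j, -, rfl⟩ := hi
      apply hr.monotone
      rw [Fin.le_def]
      have := j.2
      simp only [Fin.castLEEmb_apply, Fin.val_castLE]
      omega)
  rw [hcard] at hle
  obtain ⟨u, hu1, hu2, hu⟩ := hs.explores hr.injective hc
  exact ⟨s, i, u, hs, ⟨i, hs.1.mono (by omega), hu⟩, hu2, hle⟩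

/-- With at least D ants the quotient vanishes. -/
theorem mul_div_min_le {k D : ℕ} (hk : 0 < k) :
    ((D * ((D - 1) / min k D) : ℕ) : ℝ) ≤ (D : ℝ) ^ 2 / k := by
  rcases le_total k D with h | h
  · rw [min_eq_left h]
    calc ((D * ((D - 1) / k) : ℕ) : ℝ) = D * (((D - 1) / k : ℕ) : ℝ) := by push_cast; ring
      _ ≤ D * ((D : ℝ) / k) := by
        gcongr
        refine Nat.cast_div_le.trans ?_
        gcongr
        omega
      _ = (D : ℝ) ^ 2 / k := by ring
  · rw [min_eq_right h]
    rcases Nat.eq_zero_or_pos D with rfl | hD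
    · simp
    · rw [Nat.div_eq_of_lt (by omega)]
      simp only [mul_zero, Nat.cast_zero]
      positivity

end Run

/-- The treasure is found in time, and few pheromones are emitted until then. -/
theorem search_bound {k : ℕ} {r : Fin k → ℕ} (hr : StrictMono r) {D : ℕ} {m : Fin k}
    (hm : (m : ℕ) = min k D - 1) {c : Cell} (hc : dist c = D) :
    ∃ T : ℕ, IsLeast {t | FoundAt syncAnt r c t} T ∧
      (T : ℝ) ≤ r m +
        (85 * Fintype.card SyncState + 33) * ((D : ℝ) + (D : ℝ) ^ 2 / (k : ℝ)) ∧
      (pheromonesEmitted syncAnt r T : ℝ) ≤ (85 * Fintype.card SyncState + 33) * (D : ℝ) := by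
  classical
  have hk : 0 < k := m.pos
  have hleast : ∀ u, FoundAt syncAnt r c u →
      ∃ T ≤ u, IsLeast {t | FoundAt syncAnt r c t} T := fun u hu =>
    ⟨Nat.find ⟨u, hu⟩, Nat.find_le hu, Nat.find_spec ⟨u, hu⟩, fun _ h => Nat.find_le h⟩
  have hpos : (0 : ℝ) ≤ (D : ℝ) ^ 2 / k := by positivity
  have hcard : (0 : ℝ) ≤ Fintype.card SyncState := Nat.cast_nonneg _
  rcases Nat.eq_zero_or_pos D with rfl | hD
  -- Truncated subtraction makes `m` the first ant: the treasure is found at its release, before any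
  -- emission.
  · have hnest : c = nest := by
      obtain ⟨x, y⟩ := c
      have : x.natAbs + y.natAbs = 0 := hc
      exact Prod.ext (show x = 0 by omega) (show y = 0 by omega)
    obtain ⟨T, hT, hl⟩ := hleast (r m)
      ⟨m, le_rfl, by rw [hnest]; exact pos_release hr.injective _⟩
    refine ⟨T, hl, ?_, ?_⟩
    · simpa using hT
    · have : pheromonesEmitted syncAnt r T = 0 := by
        refine Finset.sum_eq_zero fun t ht => ?_
        rw [Finset.card_eq_zero, Finset.filter_eq_empty_iff]
        rintro i - ⟨hi, -⟩
        have h1 : r i ≤ t := hi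
        have h2 : r m ≤ r i := hr.monotone (Fin.le_def.2 (by simp [hm]))
        rw [Finset.mem_range] at ht
        omega
      simp [this]
  · obtain ⟨s, i, u, hs, hu, hus, hsR⟩ := exists_foundAt_le hr hD hm hc
    obtain ⟨T, hT, hl⟩ := hleast u hu
    have hD' : (1 : ℝ) ≤ D := by exact_mod_cast hD
    refine ⟨T, hl, ?_, ?_⟩
    -- Here 31 = 17 + 14, the claim bound plus the duty up to the end of the layer; the final 2 is
    -- at most 2D.
    · have h1 : T ≤ r m + 17 * (D * ((D - 1) / min k D)) + 31 * D + 2 := by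
        have : 17 * D * ((D - 1) / min k D + 1) = 17 * (D * ((D - 1) / min k D)) + 17 * D := by
          ring
        omega
      have h2 := mul_div_min_le (D := D) hk
      have h3 : (T : ℝ) ≤ r m +
          17 * ((D * ((D - 1) / min k D) : ℕ) : ℝ) + 31 * D + 2 := by exact_mod_cast h1
      have h4 : 0 ≤ (85 * (Fintype.card SyncState : ℝ)) * ((D : ℝ) + (D : ℝ) ^ 2 / k) := by
        positivity
      linarith
    · have h1 := pheromonesEmitted_le hr.injective hs (hT.trans hus)
      have h2 : Fintype.card SyncState * ((15 * D + 2) * 5) ≤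
          Fintype.card SyncState * (85 * D) := Nat.mul_le_mul_left _ (by omega)
      have h3 : (pheromonesEmitted syncAnt r T : ℝ) ≤ Fintype.card SyncState * (85 * D) := by
        exact_mod_cast h1.trans h2
      linarith

end AntForaging

theorem mainTheorem4 :
    (∃ C : ℝ, ∀ (k : ℕ) (hk : 0 < k) (release : Fin k → ℕ), StrictMono release →
      ∀ (D : ℕ) (treasure : AntForaging.Cell), AntForaging.dist treasure = D →
        ∃ T : ℕ,
          IsLeast {t | AntForaging.FoundAt AntForaging.syncAnt release treasure t} T ∧
          (T : ℝ) ≤ (release ⟨min k D - 1, by omega⟩ : ℝ) + C * ((D : ℝ) + (D : ℝ) ^ 2 / (k : ℝ)) ∧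
          (AntForaging.pheromonesEmitted AntForaging.syncAnt release T : ℝ) ≤ C * (D : ℝ)) ∧
    (∀ (k : ℕ) (release : Fin k → ℕ), StrictMono release →
      (∀ (t : ℕ) (i j : Fin k), ¬ AntForaging.Collide AntForaging.syncAnt release t i j) ∧
      (∀ (s t : ℕ) (i j : Fin k) (l : ℕ), AntForaging.StartsLayer release s i l →
        AntForaging.StartsLayer release t j l → i = j ∧ s = t) ∧
      (∀ (t : ℕ) (i : Fin k) (l : ℕ), AntForaging.StartsLayer release t i l →
        ∀ c : AntForaging.Cell, AntForaging.dist c = l →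
          ∃ s, t ≤ s ∧ s ≤ t + 8 * l ∧ (AntForaging.run AntForaging.syncAnt release s).pos i = c)) := by
  refine ⟨⟨_, fun k hk r hr D c hc => AntForaging.search_bound hr rfl hc⟩,
    fun k r hr => ⟨AntForaging.not_collide hr.injective, ?_, ?_⟩⟩
  · intro s t i j l hs ht
    obtain ⟨u, hu, rfl⟩ := hs.claims hr.injective
    obtain ⟨v, hv, rfl⟩ := ht.claims hr.injective
    obtain ⟨rfl, rfl⟩ := hu.unique hr.injective hv
    exact ⟨rfl, rfl⟩
  · intro t i l ht c hc
    obtain ⟨u, hu, rfl⟩ := ht.claims hr.injective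
    obtain ⟨v, h1, h2, h3⟩ := hu.explores hr.injective hc
    exact ⟨v, h1, by omega, h3⟩
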